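/- A rectangular city with $k\ge 1$ buildings consists of an axis-aligned rectangle $P=[x_0,x_1]\times[y_0,y_1]$ with $x_0<x_1$, $y_0<y_1$ and $k$ buildings $B_i=R_i\times[0,h_i]$, where $h_i>0$ and the bases $R_i=[a_i,b_i]\times[c_i,d_i]\subseteq P$ (with $a_i<b_i$, $c_i<d_i$) are pairwise disjoint. The walls of the city are the sets $\partial R_i\times[0,h_i]$, and its ground is $\bigl(P\setminus\bigcup_i \operatorname{int}R_i\bigr)\times\{0\}$. A camera with $180^\circ$ range of vision is given by a position $g\in\mathbb{R}^3$ and one of the four directions East, West, North, South (that is, $\pm e_1,\pm e_2$); it sees a point $p$ if $p$ lies in the closed half-space in front of it (the half-space bounded by the vertical plane through $g$ orthogonal to the direction $u$, namely $\langle p-g,u\rangle\ge 0$) and the segment $gp$ lies in $\bigl(P\times[0,\infty)\bigr)\setminus\bigcup_i\bigl(\operatorname{int}R_i\times[0,h_i)\bigr)$. Theorem. For every rectangular city with $k\ge 1$ buildings there is a set of at most $2k+\lfloor k/4\rfloor+4$ such cameras, each positioned at a top vertex of one of the buildings (several cameras may share a vertex), such that every point of the walls and of the ground is seen by at least one of the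 cameras. -/

import Mathlib

namespace CityGuarding

/-- Points of three-dimensional space, written as a ground position `p.1 : ℝ × ℝ`
(west-east coordinate first, south-north coordinate second) and a height `p.2`. -/
abbrev Space : Type := (ℝ × ℝ) × ℝ

/-- An axis-aligned rectangle in the plane, with sides of positive length. -/
structure Rect where
  west : ℝ
  east : ℝ
  south : ℝ
  north : ℝ
  west_lt_east : west < east
  south_lt_north : south < north

/-- The closed region covered by a rectangle. -/
def Rect.region (R : Rect) : Set (ℝ × ℝ) :=
  Set.Icc R.west R.east ×ˢ Set.Icc R.south R.north

/-- The four corners of a rectangle. -/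
def Rect.corners (R : Rect) : Set (ℝ × ℝ) :=
  {R.west, R.east} ×ˢ {R.south, R.north}

/-- A vertical building standing on the ground (height `0`), with an axis-aligned rectangular
base and positive height. -/
structure Building where
  base : Rect
  height : ℝ
  height_pos : 0 < height

/-- The four vertical walls of a building. -/
def Building.walls (B : Building) : Set Space :=
  frontier B.base.region ×ˢ Set.Icc 0 B.height

/-- The points strictly inside the walls of a building and strictly below its roof. -/
def Building.inside (B : Building) : Set Space :=
  interior B.base.region ×ˢ Set.Iio B.height

/-- The four top vertices of a building. -/
def Building.topVertices (B : Building) : Set Space :=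
  B.base.corners ×ˢ {B.height}

/-- A rectangular city with `k` buildings with pairwise disjoint (closed) bases, inside a bounding
axis-aligned rectangle. -/
structure City (k : ℕ) where
  boundary : Rect
  building : Fin k → Building
  base_subset : ∀ i, (building i).base.region ⊆ boundary.region
  base_disjoint : Pairwise fun i j =>
    Disjoint (building i).base.region (building j).base.region

/-- The space in which lines of sight may run: the points above the bounding rectangle, at
non-negative height, that are not inside a building. Walls, roofs and ground belong to it. -/
def City.freeSpace {k : ℕ} (C : City k) : Set Space :=
  (C.boundary.region ×ˢ Set.Ici 0) \ ⋃ i, (C.building i).inside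

/-- The ground of the city: the points of height `0` that are not under a building (the feet of
the walls are included). -/
def City.ground {k : ℕ} (C : City k) : Set Space :=
  (C.boundary.region \ ⋃ i, interior (C.building i).base.region) ×ˢ {0}

/-- All the walls of all the buildings of the city. -/
def City.walls {k : ℕ} (C : City k) : Set Space :=
  ⋃ i, (C.building i).walls

/-- The four axis-aligned viewing directions. -/
inductive Direction where
  | east
  | west
  | north
  | south

/-- The closed half-space in front of an observer at `g` who looks in the given direction; it is
bounded by the vertical plane through `g` orthogonal to the direction. -/
def halfSpace (g : Space) : Direction → Set Space
  | .east => {p | g.1.1 ≤ p.1.1}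
  | .west => {p | p.1.1 ≤ g.1.1}
  | .north => {p | g.1.2 ≤ p.1.2}
  | .south => {p | p.1.2 ≤ g.1.2}

/-- A camera with 180° range of vision: its position and the direction that it faces. -/
structure Camera where
  position : Space
  facing : Direction

/-- The camera `c` sees the point `p` of the city `C`: the point lies in the half-space in front
of the camera, and the line of sight does not leave the free space. -/
def Camera.Sees {k : ℕ} (C : City k) (c : Camera) (p : Space) : Prop :=
  p ∈ halfSpace c.position c.facing ∧ segment ℝ c.position p ⊆ C.freeSpace

end CityGuarding

namespace CityGuarding

/-! Heights play no role: a segment between points over the city at nonnegative height is free as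
soon as its plan avoids the interiors of the bases. So it suffices to guard the plane outside
disjoint rectangles from their corners (`guardable`).

From a southernmost rectangle `o`, follow a path north that turns west around each obstacle.
Rectangles east of the path get cameras at the NW corner facing north and the SE corner facing east;
those west of it, at the SW corner facing west and the NE corner facing north. By `seen_of_right`
and `seen_of_left` this guards everything north of the south side of `o`, provided each rectangle on
the path gets an extra SW camera facing west. One south-facing camera at `o` does the rest, so the
cost is `2k + |chain o| + 1` (`guardable_chain`).

Reflections yield four such paths, any two sharing at most one rectangle. By inclusion–exclusion
their lengths total at most `k + 6`, so one of them is short enough. -/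

/-- A family of axis-parallel rectangles with pairwise disjoint closures, given by the coordinates
of their west, east, south and north sides. -/
structure Layout (ι : Type*) where
  w : ι → ℝ
  e : ι → ℝ
  s : ι → ℝ
  n : ι → ℝ
  w_lt_e : ∀ i, w i < e i
  s_lt_n : ∀ i, s i < n i
  disj : ∀ i j, i ≠ j → e i < w j ∨ e j < w i ∨ n i < s j ∨ n j < s i

namespace Layout

variable {ι : Type*} (L : Layout ι)

/-- The point `(x, y)` is interior to the rectangle `i`. -/
def Inside (i : ι) (x y : ℝ) : Prop := (L.w i < x ∧ x < L.e i) ∧ L.s i < y ∧ y < L.n i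

/-- The segment from `(x, y)` to `(x', y')` meets the interior of no rectangle. -/
def Clear (x y x' y' : ℝ) : Prop :=
  ∀ t, 0 ≤ t → t ≤ 1 → ∀ i, ¬ L.Inside i (x + t * (x' - x)) (y + t * (y' - y))

/-- `h` is the first rectangle met by the ray that goes north from the north-west corner
of `g`. -/
def Next (g h : ι) : Prop :=
  (L.w h < L.w g ∧ L.w g < L.e h ∧ L.n g < L.s h) ∧
    ∀ j, L.w j < L.w g → L.w g < L.e j → L.n g < L.s j → L.s h ≤ L.s j

/-- The rectangles met by the path that starts at `o`, goes north, and passes every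
obstacle on its west side. -/
def chain (o : ι) : Set ι := {g | Relation.ReflTransGen L.Next o g}

/-- The rectangles on the east side of the path that defines `chain o`. -/
def rightOf (o : ι) : Set ι := {j | ∃ g ∈ L.chain o, L.w g ≤ L.w j ∧ L.s g ≤ L.s j}

variable {L}

/-! ### Order along a path and its two sides -/

lemma eq_of_overlap {i j : ι} (h₁ : L.w j ≤ L.e i) (h₂ : L.w i ≤ L.e j) (h₃ : L.s j ≤ L.n i)
    (h₄ : L.s i ≤ L.n j) : i = j := by
  by_contra h
  rcases L.disj i j h with h | h | h | h <;> linarith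

lemma Next.rightUnique : Relator.RightUnique L.Next := by
  intro g h h' hh hh'
  have e1 := hh.2 h' hh'.1.1 hh'.1.2.1 hh'.1.2.2
  have e2 := hh'.2 h hh.1.1 hh.1.2.1 hh.1.2.2
  obtain ⟨⟨_, _, _⟩, _⟩ := hh
  obtain ⟨⟨_, _, _⟩, _⟩ := hh'
  have := L.s_lt_n h
  have := L.s_lt_n h'
  apply eq_of_overlap (L := L) <;> linarith

lemma exists_next [Finite ι] {g h : ι} (h₁ : L.w h < L.w g) (h₂ : L.w g < L.e h)
    (h₃ : L.n g < L.s h) : ∃ g', L.Next g g' ∧ L.s g' ≤ L.s h := by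
  obtain ⟨g', hg', hmin⟩ := Set.exists_min_image
    {j | L.w j < L.w g ∧ L.w g < L.e j ∧ L.n g < L.s j} L.s (Set.toFinite _) ⟨h, h₁, h₂, h₃⟩
  exact ⟨g', ⟨hg', fun j a b c => hmin j ⟨a, b, c⟩⟩, hmin h ⟨h₁, h₂, h₃⟩⟩

lemma lt_of_transGen {g h : ι} (hgh : Relation.TransGen L.Next g h) :
    L.w h < L.w g ∧ L.n g < L.s h := by
  induction hgh with
  | single h => exact ⟨h.1.1, h.1.2.2⟩
  | @tail u v _ h ih =>
    have := L.s_lt_n u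
    exact ⟨h.1.1.trans ih.1, by linarith [h.1.2.2]⟩

lemma transGen_or {o g h : ι} (hg : g ∈ L.chain o) (hh : h ∈ L.chain o) (hne : g ≠ h) :
    Relation.TransGen L.Next g h ∨ Relation.TransGen L.Next h g := by
  rcases Relation.ReflTransGen.total_of_right_unique Next.rightUnique hg hh with h | h
  · rcases Relation.reflTransGen_iff_eq_or_transGen.1 h with h | h
    · exact absurd h.symm hne
    · exact Or.inl h
  · rcases Relation.reflTransGen_iff_eq_or_transGen.1 h with h | h
    · exact absurd h hne
    · exact Or.inr h

/-- A path is deterministic, so any two of its rectangles are comparable along it, and each step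
moves northwest. -/
lemma chain_order {o g h : ι} (hg : g ∈ L.chain o) (hh : h ∈ L.chain o) (hne : g ≠ h) :
    (L.w h < L.w g ∧ L.n g < L.s h) ∨ (L.w g < L.w h ∧ L.n h < L.s g) :=
  (transGen_or hg hh hne).imp lt_of_transGen lt_of_transGen

lemma chain_subset_rightOf (o : ι) : L.chain o ⊆ L.rightOf o :=
  fun g hg => ⟨g, hg, le_rfl, le_rfl⟩

/-- A rectangle that is not on the east side of the path is on its west side. -/
lemma e_le_w_of_notMem_rightOf [Finite ι] {o j g : ι} (ho : ∀ i, L.s o ≤ L.s i)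
    (hj : j ∉ L.rightOf o) (hg : g ∈ L.chain o) (hgj : L.s g ≤ L.n j) : L.e j ≤ L.w g := by
  have low : ∀ g ∈ L.chain o, L.s g ≤ L.s j → L.e j ≤ L.w g := by
    intro g₀ hg₀ hs₀
    by_contra! hlt₀
    -- The highest offending rectangle has `j` above its NW corner, so the path's next rectangle
    -- starts no higher than `j` and offends as well.
    obtain ⟨g, ⟨hg, hs, hlt⟩, hmax⟩ := Set.exists_max_image
      {g | g ∈ L.chain o ∧ L.s g ≤ L.s j ∧ L.w g < L.e j} L.s (Set.toFinite _)
      ⟨g₀, hg₀, hs₀, hlt₀⟩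
    have hw : L.w j < L.w g := by
      by_contra! h
      exact hj ⟨g, hg, h, hs⟩
    have hn : L.n g < L.s j := by
      by_contra! h
      have := L.w_lt_e g
      have := L.s_lt_n j
      have : g = j := eq_of_overlap (L := L) (by linarith) (by linarith) h (by linarith)
      exact hw.ne (by rw [this])
    obtain ⟨g', hg', hs'⟩ := exists_next hw hlt hn
    have := hmax g' ⟨hg.tail hg', hs', hg'.1.1.trans hlt⟩
    have := L.s_lt_n g
    linarith [hg'.1.2.2]
  by_contra! hlt₀
  -- By `low`, the lowest offender starts above the south side of `j`, so it has a predecessor.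
  -- Disjointness puts the offender west of `j`, and the predecessor, whose west side lies under it,
  -- offends too.
  obtain ⟨g, ⟨hg, hs, hlt⟩, hmin⟩ := Set.exists_min_image
    {g | g ∈ L.chain o ∧ L.s g ≤ L.n j ∧ L.w g < L.e j} L.s (Set.toFinite _) ⟨g, hg, hgj, hlt₀⟩
  have hsj : L.s j < L.s g := by
    by_contra! h
    exact absurd (low g hg h) (not_le.2 hlt)
  rcases Relation.ReflTransGen.cases_tail hg with rfl | ⟨g', hg', hn⟩
  · exact absurd (ho j) (not_le.2 hsj)
  · have := L.s_lt_n g'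
    have := L.s_lt_n g
    obtain ⟨⟨h1, h2, h3⟩, _⟩ := hn
    have hne : L.e g < L.w j := by
      by_contra! h
      have : g = j := eq_of_overlap (L := L) h hlt.le (by linarith) hs
      exact hsj.ne (by rw [this])
    have := L.w_lt_e j
    have := hmin g' ⟨hg', by linarith, by linarith⟩
    linarith

/-! ### Visibility -/

lemma exists_of_not_clear {x y x' y' : ℝ} (h : ¬ L.Clear x y x' y') :
    ∃ t, 0 ≤ t ∧ t ≤ 1 ∧ ∃ i, L.Inside i (x + t * (x' - x)) (y + t * (y' - y)) := by
  unfold Clear at h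
  push Not at h
  exact h

lemma pos_of_inside {x y x' y' t : ℝ} {i : ι} (hp : ∀ i, ¬ L.Inside i x y) (ht : 0 ≤ t)
    (h : L.Inside i (x + t * (x' - x)) (y + t * (y' - y))) : 0 < t := by
  refine ht.lt_of_ne ?_
  rintro rfl
  apply hp i
  simpa using h

/-- Among the NW corners in the box, take the one of least slope from `(x, y)`. A rectangle blocking
the view to it, or to any point of that line, has its NW corner strictly above the line, hence of
smaller slope. -/
lemma clear_or_exists_northwest [Finite ι] {x y qx qy : ℝ} (hp : ∀ i, ¬ L.Inside i x y)
    (hqx : qx ≤ x) (hqy : qy ≤ y)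
    (H : ∀ f u v, qx ≤ u → u ≤ x → qy ≤ v → v ≤ y → L.Inside f u v → qx ≤ L.w f ∧ L.n f ≤ y) :
    L.Clear x y qx qy ∨
      ∃ f, qx ≤ L.w f ∧ L.w f ≤ x ∧ qy ≤ L.n f ∧ L.n f ≤ y ∧ L.Clear x y (L.w f) (L.n f) := by
  by_cases hcl : L.Clear x y qx qy
  · exact Or.inl hcl
  right
  obtain ⟨t, ht0, ht1, f₁, hf₁⟩ := exists_of_not_clear hcl
  have key : ∀ f u v, qx ≤ u → u ≤ x → qy ≤ v → v ≤ y → L.Inside f u v →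
      qx ≤ L.w f ∧ L.w f < x ∧ qy ≤ L.n f ∧ L.n f ≤ y := by
    intro f u v h1 h2 h3 h4 h5
    obtain ⟨h6, h7⟩ := H f u v h1 h2 h3 h4 h5
    obtain ⟨⟨_, _⟩, _, _⟩ := h5
    exact ⟨h6, by linarith, by linarith, h7⟩
  obtain ⟨f₀, ⟨m1, m2, m3, m4⟩, hmin⟩ := Set.exists_min_image
    {f | qx ≤ L.w f ∧ L.w f < x ∧ qy ≤ L.n f ∧ L.n f ≤ y}
    (fun f => (y - L.n f) / (x - L.w f)) (Set.toFinite _)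
    ⟨f₁, key f₁ _ _ (by nlinarith) (by nlinarith) (by nlinarith) (by nlinarith) hf₁⟩
  refine ⟨f₀, m1, m2.le, m3, m4, ?_⟩
  intro t ht0 ht1 f hf
  have htpos := pos_of_inside hp ht0 hf
  have hF := key f _ _ (by nlinarith) (by nlinarith) (by nlinarith) (by nlinarith) hf
  have hle := hmin f hF
  obtain ⟨_, h2, _, h4⟩ := hF
  obtain ⟨⟨i1, _⟩, _, i4⟩ := hf
  rw [div_le_div_iff₀ (by linarith) (by linarith)] at hle
  have e1 : (y - L.n f) * (x - L.w f₀) < t * (y - L.n f₀) * (x - L.w f₀) :=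
    mul_lt_mul_of_pos_right (by linarith) (by linarith)
  have e2 : (y - L.n f₀) * (t * (x - L.w f₀)) ≤ (y - L.n f₀) * (x - L.w f) :=
    mul_le_mul_of_nonneg_left (by linarith) (by linarith)
  linarith

/-- Mirror argument for SW corners: a blocker has its SW corner strictly to the lower left of a
point of the sight line, hence a smaller ratio. -/
lemma clear_southwest_of_minimal {x y : ℝ} {F : Set ι} (hp : ∀ i, ¬ L.Inside i x y)
    (hF : ∀ f ∈ F, x ≤ L.w f ∧ L.s f < y) {f₀ : ι} (hf₀ : f₀ ∈ F)
    (H : ∀ f u v, x ≤ u → u ≤ L.w f₀ → L.s f₀ ≤ v → v ≤ y → L.Inside f u v → f ∈ F)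
    (hmin : ∀ f ∈ F, (L.w f₀ - x) / (y - L.s f₀) ≤ (L.w f - x) / (y - L.s f)) :
    L.Clear x y (L.w f₀) (L.s f₀) := by
  intro t ht0 ht1 f hf
  have htpos := pos_of_inside hp ht0 hf
  obtain ⟨m1, m2⟩ := hF f₀ hf₀
  have hfF := H f _ _ (by nlinarith) (by nlinarith) (by nlinarith) (by nlinarith) hf
  have hle := hmin f hfF
  obtain ⟨h1, h2⟩ := hF f hfF
  obtain ⟨⟨i1, _⟩, i3, _⟩ := hf
  rw [div_le_div_iff₀ (by linarith) (by linarith)] at hle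
  have e1 : (L.w f - x) * (y - L.s f₀) < t * (L.w f₀ - x) * (y - L.s f₀) :=
    mul_lt_mul_of_pos_right (by linarith) (by linarith)
  have e2 : (L.w f₀ - x) * (t * (y - L.s f₀)) ≤ (L.w f₀ - x) * (y - L.s f) :=
    mul_le_mul_of_nonneg_left (by linarith) (by linarith)
  linarith

/-- Points on the east side of the path are seen by cameras on that side. -/
lemma seen_of_right [Finite ι] {o : ι} (ho : ∀ i, L.s o ≤ L.s i) {x y : ℝ}
    (hp : ∀ i, ¬ L.Inside i x y) (hright : ∃ g ∈ L.chain o, L.w g < x ∧ L.s g < y) :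
    ∃ j ∈ L.rightOf o, (L.n j ≤ y ∧ L.Clear x y (L.w j) (L.n j)) ∨
      (L.e j ≤ x ∧ L.Clear x y (L.e j) (L.s j)) := by
  by_cases hH : ∃ h, h ∈ L.rightOf o ∧ L.s h < y ∧ y < L.n h ∧ L.e h ≤ x
  · obtain ⟨h, ⟨hR, hs, hn, he⟩, hmax⟩ := Set.exists_max_image
      -- The easternmost such obstacle due west of the point; the target is its SE corner.
      {h | h ∈ L.rightOf o ∧ L.s h < y ∧ y < L.n h ∧ L.e h ≤ x} L.e (Set.toFinite _) hH
    obtain ⟨g, hg, hgw, hgs⟩ := hR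
    have hwe := L.w_lt_e h
    have memR : ∀ f, L.e h < L.e f → L.s h ≤ L.n f → f ∈ L.rightOf o := by
      intro f h1 h2
      by_contra hf
      have := e_le_w_of_notMem_rightOf ho hf hg (by linarith)
      linarith
    have hcl := clear_or_exists_northwest hp he hs.le (fun f u v h1 h2 h3 h4 hf => by
      obtain ⟨⟨i1, i2⟩, i3, i4⟩ := hf
      have hfR := memR f (by linarith) (by linarith)
      constructor
      · by_contra! hlt
        have : f = h := eq_of_overlap (L := L) (by linarith) (by linarith) (by linarith)
          (by linarith)
        rw [this] at i2
        linarith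
      · by_contra! hlt
        have hfe : L.e f ≤ x := by
          by_contra! hlt'
          exact hp f ⟨⟨by linarith, hlt'⟩, by linarith, hlt⟩
        have := hmax f ⟨hfR, by linarith, hlt, hfe⟩
        linarith)
    rcases hcl with hc | hc
    · exact ⟨h, ⟨g, hg, hgw, hgs⟩, Or.inr ⟨he, hc⟩⟩
    · obtain ⟨f, h1, h2, h3, h4, h5⟩ := hc
      have := L.w_lt_e f
      exact ⟨f, memR f (by linarith) h3, Or.inl ⟨h4, h5⟩⟩
  · push Not at hH
    -- With no obstacle due west, the target is the NW corner of the highest path rectangle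
    -- available.
    obtain ⟨g, ⟨hg, hgw, hgs⟩, hmax⟩ := Set.exists_max_image
      {g | g ∈ L.chain o ∧ L.w g < x ∧ L.s g < y} L.s (Set.toFinite _) hright
    have hsn := L.s_lt_n g
    have hwe := L.w_lt_e g
    have hgn : L.n g ≤ y := by
      by_contra! hlt
      refine hp g ⟨⟨hgw, hH g (chain_subset_rightOf o hg) hgs hlt⟩, hgs, hlt⟩
    have memR : ∀ f, L.w g < L.e f → L.n g ≤ L.n f → f ∈ L.rightOf o := by
      intro f h1 h2
      by_contra hf
      have := e_le_w_of_notMem_rightOf ho hf hg (by linarith)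
      linarith
    have hcl := clear_or_exists_northwest hp hgw.le hgn (fun f u v h1 h2 h3 h4 hf => by
      obtain ⟨⟨i1, i2⟩, i3, i4⟩ := hf
      have hfR := memR f (by linarith) (by linarith)
      constructor
      · by_contra! hlt
        have hfs : L.n g < L.s f := by
          by_contra! h
          have : f = g := eq_of_overlap (L := L) (by linarith) (by linarith) (by linarith)
            (by linarith)
          rw [this] at hlt
          linarith
        obtain ⟨g', hg', hs'⟩ := exists_next hlt (by linarith) hfs
        have := hmax g' ⟨hg.tail hg', hg'.1.1.trans hgw, by linarith⟩
        linarith [hg'.1.2.2]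
      · by_contra! hlt
        exact hp f ⟨⟨by linarith, hH f hfR (by linarith) hlt⟩, by linarith, hlt⟩)
    rcases hcl with hc | hc
    · exact ⟨g, chain_subset_rightOf o hg, Or.inl ⟨hgn, hc⟩⟩
    · obtain ⟨f, h1, h2, h3, h4, h5⟩ := hc
      have := L.w_lt_e f
      exact ⟨f, memR f (by linarith) h3, Or.inl ⟨h4, h5⟩⟩

/-- Points on the west side of the path are seen by cameras on that side or on the path. -/
lemma seen_of_left [Finite ι] {o : ι} (ho : ∀ i, L.s o ≤ L.s i) {x y : ℝ}
    (hp : ∀ i, ¬ L.Inside i x y) (hy : L.s o < y)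
    (hleft : ∀ g ∈ L.chain o, L.s g < y → x ≤ L.w g) :
    ∃ j, ((j ∉ L.rightOf o ∨ j ∈ L.chain o) ∧ x ≤ L.w j ∧ L.Clear x y (L.w j) (L.s j)) ∨
      (j ∉ L.rightOf o ∧ L.n j ≤ y ∧ L.Clear x y (L.e j) (L.n j)) := by
  have main : ∀ F : Set ι, F.Nonempty → (∀ f ∈ F, x ≤ L.w f ∧ L.s f < y) →
      (∀ f₀ ∈ F, ∀ f u v, x ≤ u → u ≤ L.w f₀ → L.s f₀ ≤ v → v ≤ y → L.Inside f u v → f ∈ F) →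
      (∀ f ∈ F, ∀ g ∈ L.chain o, L.w g ≤ L.w f → L.s g ≤ L.s f → g ∈ F) →
      ∃ j, (j ∉ L.rightOf o ∨ j ∈ L.chain o) ∧ x ≤ L.w j ∧ L.Clear x y (L.w j) (L.s j) := by
    intro F hne hF hblock hwit
    obtain ⟨f₀, hf₀, hmin⟩ := Set.exists_min_image F (fun f => (L.w f - x) / (y - L.s f))
      (Set.toFinite _) hne
    by_cases hR : f₀ ∈ L.rightOf o
    -- A minimizer east of the path lacks a SW camera, but its witness on the path has no larger
    -- ratio and carries the extra one.
    · obtain ⟨g, hg, h1, h2⟩ := hR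
      have hgF := hwit f₀ hf₀ g hg h1 h2
      refine ⟨g, Or.inr hg, (hF g hgF).1, clear_southwest_of_minimal hp hF hgF (hblock g hgF) ?_⟩
      intro f hf
      refine le_trans ?_ (hmin f hf)
      have := hF f₀ hf₀
      have := hF g hgF
      apply div_le_div₀ <;> linarith
    · exact ⟨f₀, Or.inl hR, (hF f₀ hf₀).1,
        clear_southwest_of_minimal hp hF hf₀ (hblock f₀ hf₀) hmin⟩
  by_cases hE : ∃ f, (L.w f < x ∧ x < L.e f) ∧ L.n f ≤ y
  -- The nearest rectangle due south of the point; if its NE corner is hidden, the blockers supply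
  -- the SW corners.
  · obtain ⟨f, ⟨⟨hw, he⟩, hn⟩, hmax⟩ := Set.exists_max_image
      {f | (L.w f < x ∧ x < L.e f) ∧ L.n f ≤ y} L.n (Set.toFinite _) hE
    have hsn := L.s_lt_n f
    have hfR : f ∉ L.rightOf o := by
      rintro ⟨g, hg, h1, h2⟩
      have := hleft g hg (by linarith)
      linarith
    by_cases hc : L.Clear x y (L.e f) (L.n f)
    · exact ⟨f, Or.inr ⟨hfR, hn, hc⟩⟩
    have key : ∀ j u v, x ≤ u → u ≤ L.e f → L.n f ≤ v → v ≤ y → L.Inside j u v →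
        (x ≤ L.w j ∧ L.w j < L.e f) ∧ L.n f ≤ L.s j ∧ L.s j < y := by
      rintro j u v h1 h2 h3 h4 ⟨⟨i1, i2⟩, i3, i4⟩
      refine ⟨⟨?_, by linarith⟩, ?_, by linarith⟩
      · by_contra! hlt
        by_cases hny : L.n j ≤ y
        · have := hmax j ⟨⟨hlt, by linarith⟩, hny⟩
          linarith
        · exact hp j ⟨⟨hlt, by linarith⟩, by linarith, not_le.1 hny⟩
      · by_contra! hlt
        have : j = f := eq_of_overlap (L := L) (by linarith) (by linarith) (by linarith)
          (by linarith)
        rw [this] at i4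
        linarith
    obtain ⟨t, ht0, ht1, j, hj⟩ := exists_of_not_clear hc
    obtain ⟨j', hj'⟩ := main {j | (x ≤ L.w j ∧ L.w j < L.e f) ∧ L.n f ≤ L.s j ∧ L.s j < y}
      ⟨j, key j _ _ (by nlinarith) (by nlinarith) (by nlinarith) (by nlinarith) hj⟩
      (fun j hj => ⟨hj.1.1, hj.2.2⟩)
      (fun f₀ hf₀ j u v h1 h2 h3 h4 hj =>
        key j u v h1 (h2.trans hf₀.1.2.le) (hf₀.2.1.trans h3) h4 hj)
      (fun j hj g hg h1 h2 => by
        obtain ⟨⟨a1, a2⟩, a3, a4⟩ := hj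
        refine ⟨⟨hleft g hg (by linarith), by linarith⟩, ?_, by linarith⟩
        by_contra! hlt
        have := e_le_w_of_notMem_rightOf ho hfR hg hlt.le
        linarith)
    exact ⟨j', Or.inl hj'⟩
  · push Not at hE
    obtain ⟨j, hj⟩ := main {j | x ≤ L.w j ∧ L.s j < y}
      ⟨o, hleft o Relation.ReflTransGen.refl hy, hy⟩ (fun j hj => hj)
      (fun f₀ hf₀ j u v h1 h2 h3 h4 hj => by
        obtain ⟨⟨i1, i2⟩, i3, i4⟩ := hj
        refine ⟨?_, by linarith⟩
        by_contra! hlt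
        exact hp j ⟨⟨hlt, by linarith⟩, by linarith, hE j ⟨hlt, by linarith⟩⟩)
      (fun f hf g hg h1 h2 => ⟨hleft g hg (h2.trans_lt hf.2), h2.trans_lt hf.2⟩)
    exact ⟨j, Or.inl hj⟩

/-! ### Symmetries -/

variable (L) in
/-- The layout reflected in the west-east axis. -/
def flip : Layout ι where
  w := L.w
  e := L.e
  s i := -L.n i
  n i := -L.s i
  w_lt_e := L.w_lt_e
  s_lt_n i := neg_lt_neg (L.s_lt_n i)
  disj i j h := by
    rcases L.disj i j h with h | h | h | h
    · exact Or.inl h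
    · exact Or.inr (Or.inl h)
    · exact Or.inr (Or.inr (Or.inr (neg_lt_neg h)))
    · exact Or.inr (Or.inr (Or.inl (neg_lt_neg h)))

variable (L) in
/-- The layout reflected in the diagonal. -/
def swap : Layout ι where
  w := L.s
  e := L.n
  s := L.w
  n := L.e
  w_lt_e := L.s_lt_n
  s_lt_n := L.w_lt_e
  disj i j h := by
    have := L.disj i j h
    tauto

/-! ### Intersections of paths -/

variable {o o' : ι}

/-- On one path the more westerly of two rectangles is the more northerly, on the other the more
southerly. -/
lemma subsingleton_chain_inter_chain_flip :
    (L.chain o ∩ L.flip.chain o').Subsingleton := by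
  rintro g ⟨hg, hg'⟩ h ⟨hh, hh'⟩
  by_contra hne
  have h1 := chain_order hg hh hne
  have h2 := chain_order hg' hh' hne
  simp only [flip] at h2
  have := L.s_lt_n g
  have := L.s_lt_n h
  rcases h1 with ⟨_, _⟩ | ⟨_, _⟩ <;> rcases h2 with ⟨_, _⟩ | ⟨_, _⟩ <;> linarith

lemma subsingleton_chain_inter_chain_swap_flip :
    (L.chain o ∩ L.flip.swap.chain o').Subsingleton := by
  rintro g ⟨hg, hg'⟩ h ⟨hh, hh'⟩
  by_contra hne
  have h1 := chain_order hg hh hne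
  have h2 := chain_order hg' hh' hne
  simp only [flip, swap] at h2
  have := L.s_lt_n g
  have := L.s_lt_n h
  have := L.w_lt_e g
  have := L.w_lt_e h
  rcases h1 with ⟨_, _⟩ | ⟨_, _⟩ <;> rcases h2 with ⟨_, _⟩ | ⟨_, _⟩ <;> linarith

lemma subsingleton_chain_inter_chain_flip_swap :
    (L.chain o ∩ L.swap.flip.chain o').Subsingleton := by
  rintro g ⟨hg, hg'⟩ h ⟨hh, hh'⟩
  by_contra hne
  have h1 := chain_order hg hh hne
  have h2 := chain_order hg' hh' hne
  simp only [flip, swap] at h2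
  have := L.s_lt_n g
  have := L.s_lt_n h
  have := L.w_lt_e g
  have := L.w_lt_e h
  rcases h1 with ⟨_, _⟩ | ⟨_, _⟩ <;> rcases h2 with ⟨_, _⟩ | ⟨_, _⟩ <;> linarith

lemma subsingleton_of_transGen {s : Set ι}
    (H : ∀ g ∈ L.chain o, g ∈ s → ∀ h ∈ s, ¬ Relation.TransGen L.Next g h) :
    (L.chain o ∩ s).Subsingleton := by
  rintro g ⟨hg, hg'⟩ h ⟨hh, hh'⟩
  by_contra hne
  rcases transGen_or hg hh hne with h1 | h1
  · exact H g hg hg' h hh' h1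
  · exact H h hh hh' g hg' h1

/-- Both paths run northwest, so order alone does not decide. They cross: beyond a common rectangle,
`chain o` stays outside the `rightOf` of the other path. -/
lemma subsingleton_chain_inter_chain_antiswap [Finite ι]
    (ho' : ∀ i, L.flip.swap.flip.s o' ≤ L.flip.swap.flip.s i) :
    (L.chain o ∩ L.flip.swap.flip.chain o').Subsingleton := by
  refine subsingleton_of_transGen fun g _ hg h hh hgh => ?_
  suffices h ∉ L.flip.swap.flip.rightOf o' from this (chain_subset_rightOf _ hh)
  clear hh
  induction hgh with
  | @single u hu =>
    rintro ⟨l, hl, h1, h2⟩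
    obtain ⟨⟨h3, h4, h5⟩, _⟩ := hu
    have := L.s_lt_n u
    have := L.w_lt_e l
    simp only [flip, swap] at h1 h2
    rcases eq_or_ne g l with rfl | hne
    · linarith
    · have h6 := chain_order hg hl hne
      simp only [flip, swap] at h6
      rcases h6 with ⟨_, _⟩ | ⟨_, _⟩ <;> linarith
  | @tail v u _ hu ih =>
    rintro ⟨l, hl, h1, h2⟩
    obtain ⟨⟨h3, h4, h5⟩, _⟩ := hu
    have := L.s_lt_n u
    have := L.s_lt_n v
    simp only [flip, swap] at h1 h2
    have := e_le_w_of_notMem_rightOf ho' ih hl (by simp only [flip, swap]; linarith)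
    simp only [flip, swap] at this
    linarith

/-- The paths follow one diagonal in opposite senses. Beyond a common `g`, `chain o` stays in the
other `rightOf`; the witness `r` for the predecessor of a second common `h` then violates
`chain_order` for `r` and `h`. -/
lemma subsingleton_chain_inter_chain_swap [Finite ι] (ho' : ∀ i, L.swap.s o' ≤ L.swap.s i) :
    (L.chain o ∩ L.swap.chain o').Subsingleton := by
  refine subsingleton_of_transGen fun g _ hg h hh hgh => ?_
  have step : ∀ v u, L.Next v u → v ∈ L.swap.rightOf o' → u ∈ L.swap.rightOf o' := by
    rintro v u ⟨⟨h3, h4, h5⟩, _⟩ ⟨r, hr, h1, h2⟩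
    by_contra hu
    simp only [swap] at h1 h2
    have := e_le_w_of_notMem_rightOf ho' hu hr (by simp only [swap]; linarith)
    simp only [swap] at this
    have := L.s_lt_n u
    have := L.s_lt_n v
    linarith
  have mem : ∀ v, Relation.ReflTransGen L.Next g v → v ∈ L.swap.rightOf o' := by
    intro v hv
    induction hv with
    | refl => exact chain_subset_rightOf _ hg
    | tail _ hu ih => exact step _ _ hu ih
  obtain ⟨v, hgv, ⟨⟨h3, h4, h5⟩, _⟩⟩ := Relation.TransGen.tail'_iff.1 hgh
  obtain ⟨r, hr, h1, h2⟩ := mem v hgv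
  simp only [swap] at h1 h2
  have := L.s_lt_n v
  have := L.w_lt_e r
  rcases eq_or_ne r h with rfl | hne
  · linarith
  · have h6 := chain_order hr hh hne
    simp only [swap] at h6
    have := L.s_lt_n r
    have := L.s_lt_n h
    rcases h6 with ⟨_, _⟩ | ⟨_, _⟩ <;> linarith

/-! ### Cameras in the plane -/

/-- `(x', y')` lies in the closed half-plane in front of an observer at `(x, y)`. -/
def InFront : Direction → ℝ → ℝ → ℝ → ℝ → Prop
  | .east, x, _, x', _ => x ≤ x'
  | .west, x, _, x', _ => x' ≤ x
  | .north, _, y, _, y' => y ≤ y'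
  | .south, _, y, _, y' => y' ≤ y

variable (L) in
/-- The layout can be guarded by at most `N` cameras with 180° range at corners. A camera is given
by the rectangle at which it stands, its position and its direction. -/
def Guardable (N : ℕ) : Prop :=
  ∃ G : Finset (ι × (ℝ × ℝ) × Direction), G.card ≤ N ∧
    (∀ c ∈ G, (c.2.1.1 = L.w c.1 ∨ c.2.1.1 = L.e c.1) ∧
      (c.2.1.2 = L.s c.1 ∨ c.2.1.2 = L.n c.1)) ∧
    ∀ x y, (∀ i, ¬ L.Inside i x y) →
      ∃ c ∈ G, InFront c.2.2 c.2.1.1 c.2.1.2 x y ∧ L.Clear x y c.2.1.1 c.2.1.2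

lemma Guardable.of_flip {N : ℕ} (h : L.flip.Guardable N) : L.Guardable N := by
  classical
  obtain ⟨G, hN, hG, hc⟩ := h
  let D : Direction → Direction
    | .east => .east
    | .west => .west
    | .north => .south
    | .south => .north
  have hins : ∀ i x y, L.flip.Inside i x (-y) ↔ L.Inside i x y := by
    intro i x y
    simp only [Inside, flip, neg_lt_neg_iff]
    tauto
  refine ⟨G.image fun c => (c.1, (c.2.1.1, -c.2.1.2), D c.2.2),
    Finset.card_image_le.trans hN, ?_, ?_⟩
  · intro c' hc'
    obtain ⟨c, hcG, rfl⟩ := Finset.mem_image.1 hc'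
    obtain ⟨h1, h2⟩ := hG c hcG
    refine ⟨h1, ?_⟩
    simp only [flip] at h2
    rcases h2 with h2 | h2
    · right; linarith
    · left; linarith
  · intro x y hp
    obtain ⟨c, hcG, h1, h2⟩ := hc x (-y) fun i hi => hp i ((hins i x y).1 hi)
    refine ⟨_, Finset.mem_image_of_mem _ hcG, ?_, ?_⟩
    · obtain ⟨i, q, d⟩ := c
      cases d <;> simp only [InFront, D] at h1 ⊢ <;> linarith
    · intro t h0 h1 i hi
      refine h2 t h0 h1 i ?_
      rw [← hins] at hi
      convert hi using 1
      ring

lemma Guardable.of_swap {N : ℕ} (h : L.swap.Guardable N) : L.Guardable N := by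
  classical
  obtain ⟨G, hN, hG, hc⟩ := h
  let D : Direction → Direction
    | .east => .north
    | .west => .south
    | .north => .east
    | .south => .west
  refine ⟨G.image fun c => (c.1, (c.2.1.2, c.2.1.1), D c.2.2),
    Finset.card_image_le.trans hN, ?_, ?_⟩
  · intro c' hc'
    obtain ⟨c, hcG, rfl⟩ := Finset.mem_image.1 hc'
    exact (hG c hcG).symm
  · intro x y hp
    obtain ⟨c, hcG, h1, h2⟩ := hc y x fun i hi => hp i hi.symm
    refine ⟨_, Finset.mem_image_of_mem _ hcG, ?_, fun t h0 h1 i hi => h2 t h0 h1 i hi.symm⟩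
    obtain ⟨i, q, d⟩ := c
    cases d <;> exact h1

lemma guardable_chain [Fintype ι] (ho : ∀ i, L.s o ≤ L.s i) :
    L.Guardable (2 * Fintype.card ι + (L.chain o).ncard + 1) := by
  classical
  let R := L.rightOf o
  let G₁ : Finset (ι × (ℝ × ℝ) × Direction) := Finset.univ.image fun j =>
    if j ∈ R then (j, (L.w j, L.n j), .north) else (j, (L.w j, L.s j), .west)
  let G₂ : Finset (ι × (ℝ × ℝ) × Direction) := Finset.univ.image fun j =>
    if j ∈ R then (j, (L.e j, L.s j), .east) else (j, (L.e j, L.n j), .north)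
  let G₃ : Finset (ι × (ℝ × ℝ) × Direction) := (L.chain o).toFinset.image fun j =>
    (j, (L.w j, L.s j), .west)
  let G₄ : Finset (ι × (ℝ × ℝ) × Direction) := {(o, (L.w o, L.s o), .south)}
  refine ⟨G₁ ∪ G₂ ∪ G₃ ∪ G₄, ?_, ?_, ?_⟩
  · have c1 : G₁.card ≤ Fintype.card ι := Finset.card_image_le
    have c2 : G₂.card ≤ Fintype.card ι := Finset.card_image_le
    have c3 : G₃.card ≤ (L.chain o).ncard := by
      rw [Set.ncard_eq_toFinset_card']
      exact Finset.card_image_le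
    have c4 : G₄.card = 1 := Finset.card_singleton _
    have d1 := Finset.card_union_le (G₁ ∪ G₂ ∪ G₃) G₄
    have d2 := Finset.card_union_le (G₁ ∪ G₂) G₃
    have d3 := Finset.card_union_le G₁ G₂
    omega
  · intro c hc
    simp only [Finset.mem_union] at hc
    rcases hc with ((hc | hc) | hc) | hc
    · obtain ⟨j, _, rfl⟩ := Finset.mem_image.1 hc
      split_ifs <;> simp
    · obtain ⟨j, _, rfl⟩ := Finset.mem_image.1 hc
      split_ifs <;> simp
    · obtain ⟨j, _, rfl⟩ := Finset.mem_image.1 hc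
      simp
    · rw [Finset.mem_singleton.1 hc]
      simp
  · intro x y hp
    have m1 : ∀ j ∈ R, (j, (L.w j, L.n j), .north) ∈ G₁ ∪ G₂ ∪ G₃ ∪ G₄ := fun j hj => by
      simp only [Finset.mem_union]
      exact Or.inl (Or.inl (Or.inl (Finset.mem_image.2 ⟨j, Finset.mem_univ _, if_pos hj⟩)))
    have m2 : ∀ j ∈ R, (j, (L.e j, L.s j), .east) ∈ G₁ ∪ G₂ ∪ G₃ ∪ G₄ := fun j hj => by
      simp only [Finset.mem_union]
      exact Or.inl (Or.inl (Or.inr (Finset.mem_image.2 ⟨j, Finset.mem_univ _, if_pos hj⟩)))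
    have m3 : ∀ j ∉ R, (j, (L.w j, L.s j), .west) ∈ G₁ ∪ G₂ ∪ G₃ ∪ G₄ := fun j hj => by
      simp only [Finset.mem_union]
      exact Or.inl (Or.inl (Or.inl (Finset.mem_image.2 ⟨j, Finset.mem_univ _, if_neg hj⟩)))
    have m4 : ∀ j ∉ R, (j, (L.e j, L.n j), .north) ∈ G₁ ∪ G₂ ∪ G₃ ∪ G₄ := fun j hj => by
      simp only [Finset.mem_union]
      exact Or.inl (Or.inl (Or.inr (Finset.mem_image.2 ⟨j, Finset.mem_univ _, if_neg hj⟩)))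
    have m5 : ∀ j ∈ L.chain o, (j, (L.w j, L.s j), .west) ∈ G₁ ∪ G₂ ∪ G₃ ∪ G₄ := fun j hj => by
      simp only [Finset.mem_union]
      exact Or.inl (Or.inr (Finset.mem_image_of_mem _ (Set.mem_toFinset.2 hj)))
    have m6 : (o, (L.w o, L.s o), .south) ∈ G₁ ∪ G₂ ∪ G₃ ∪ G₄ :=
      Finset.mem_union_right _ (Finset.mem_singleton_self _)
    by_cases hy : L.s o < y
    · by_cases hr : ∃ g ∈ L.chain o, L.w g < x ∧ L.s g < y
      · obtain ⟨j, hj, ⟨h1, h2⟩ | ⟨h1, h2⟩⟩ := seen_of_right ho hp hr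
        · exact ⟨_, m1 j hj, h1, h2⟩
        · exact ⟨_, m2 j hj, h1, h2⟩
      · push Not at hr
        obtain ⟨j, ⟨hj, h1, h2⟩ | ⟨hj, h1, h2⟩⟩ := seen_of_left ho hp hy fun g hg hgy => by
          by_contra! h
          exact absurd (hr g hg h) (not_le.2 hgy)
        · rcases hj with hj | hj
          · exact ⟨_, m3 j hj, h1, h2⟩
          · exact ⟨_, m5 j hj, h1, h2⟩
        · exact ⟨_, m4 j hj, h1, h2⟩
    · refine ⟨_, m6, not_lt.1 hy, ?_⟩
      rintro t h0 h1 i ⟨_, h2, _⟩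
      have := ho i
      dsimp only at h2
      nlinarith

/-- Every nonempty layout of `k` rectangles is guarded by `2k + ⌊k/4⌋ + 4` cameras. -/
theorem guardable [Fintype ι] [Nonempty ι] (L : Layout ι) :
    L.Guardable (2 * Fintype.card ι + Fintype.card ι / 4 + 4) := by
  classical
  have mono : ∀ {N M : ℕ} {L : Layout ι}, L.Guardable N → N ≤ M → L.Guardable M :=
    fun ⟨G, h, h'⟩ hle => ⟨G, h.trans hle, h'⟩
  obtain ⟨o₁, h₁⟩ := Finite.exists_min L.s
  obtain ⟨o₂, h₂⟩ := Finite.exists_min L.flip.s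
  obtain ⟨o₃, h₃⟩ := Finite.exists_min L.flip.swap.s
  obtain ⟨o₄, h₄⟩ := Finite.exists_min L.flip.swap.flip.s
  have key : ∀ {s t : Set ι}, (s ∩ t).Subsingleton → (s ∩ t).ncard ≤ 1 :=
    fun h => Set.ncard_le_one_iff_subsingleton.2 h
  have e1 : ((L.chain o₁) ∩ L.flip.chain o₂).ncard ≤ 1 :=
    key subsingleton_chain_inter_chain_flip
  have e2 : ((L.chain o₁) ∩ L.flip.swap.chain o₃).ncard ≤ 1 :=
    key subsingleton_chain_inter_chain_swap_flip
  have e3 : ((L.chain o₁) ∩ L.flip.swap.flip.chain o₄).ncard ≤ 1 :=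
    key (subsingleton_chain_inter_chain_antiswap h₄)
  have e4 : ((L.flip.chain o₂) ∩ L.flip.swap.chain o₃).ncard ≤ 1 :=
    key (subsingleton_chain_inter_chain_swap h₃)
  have e5 : ((L.flip.chain o₂) ∩ L.flip.swap.flip.chain o₄).ncard ≤ 1 :=
    key subsingleton_chain_inter_chain_flip_swap
  have e6 : ((L.flip.swap.chain o₃) ∩ L.flip.swap.flip.chain o₄).ncard ≤ 1 :=
    key subsingleton_chain_inter_chain_flip
  have g₁ := guardable_chain h₁
  have g₂ := (guardable_chain h₂).of_flip
  have g₃ := (guardable_chain h₃).of_swap.of_flip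
  have g₄ := (guardable_chain h₄).of_flip.of_swap.of_flip
  generalize L.chain o₁ = U at *
  generalize L.flip.chain o₂ = D at *
  generalize L.flip.swap.chain o₃ = E at *
  generalize L.flip.swap.flip.chain o₄ = W at *
  have f1 := Set.ncard_union_add_ncard_inter U D
  have f2 := Set.ncard_union_add_ncard_inter E W
  have f3 := Set.ncard_union_add_ncard_inter (U ∪ D) (E ∪ W)
  have f4 : ((U ∪ D) ∪ (E ∪ W)).ncard ≤ Fintype.card ι := by
    rw [← Nat.card_eq_fintype_card]
    exact Set.ncard_le_card _
  have f5 : ((U ∪ D) ∩ (E ∪ W)).ncard ≤ 4 := by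
    rw [Set.inter_union_distrib_left, Set.union_inter_distrib_right,
      Set.union_inter_distrib_right]
    have a1 := Set.ncard_union_le (U ∩ E ∪ D ∩ E) (U ∩ W ∪ D ∩ W)
    have a2 := Set.ncard_union_le (U ∩ E) (D ∩ E)
    have a3 := Set.ncard_union_le (U ∩ W) (D ∩ W)
    omega
  -- Otherwise the four lengths would total at least `4 * (k / 4 + 4) ≥ k + 13`, beyond `k + 6`.
  have : U.ncard ≤ Fintype.card ι / 4 + 3 ∨ D.ncard ≤ Fintype.card ι / 4 + 3 ∨
      E.ncard ≤ Fintype.card ι / 4 + 3 ∨ W.ncard ≤ Fintype.card ι / 4 + 3 := by omega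
  rcases this with h | h | h | h
  · exact mono g₁ (by omega)
  · exact mono g₂ (by omega)
  · exact mono g₃ (by omega)
  · exact mono g₄ (by omega)

end Layout

/-! ### Cities -/

namespace City

variable {k : ℕ} (C : City k)

/-- The layout of the bases of the buildings. -/
def layout : Layout (Fin k) where
  w i := (C.building i).base.west
  e i := (C.building i).base.east
  s i := (C.building i).base.south
  n i := (C.building i).base.north
  w_lt_e i := (C.building i).base.west_lt_east
  s_lt_n i := (C.building i).base.south_lt_north
  disj i j h := by
    by_contra! hc
    obtain ⟨h1, h2, h3, h4⟩ := hc
    have wi := (C.building i).base.west_lt_east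
    have wj := (C.building j).base.west_lt_east
    have si := (C.building i).base.south_lt_north
    have sj := (C.building j).base.south_lt_north
    refine Set.not_disjoint_iff.2
      ⟨(max (C.building i).base.west (C.building j).base.west,
        max (C.building i).base.south (C.building j).base.south), ?_, ?_⟩
      (C.base_disjoint h) <;>
    simp only [Rect.region, Set.mem_prod, Set.mem_Icc, le_max_iff, max_le_iff, le_refl, true_or,
      or_true, true_and] <;>
    refine ⟨⟨?_, ?_⟩, ?_, ?_⟩ <;> linarith

lemma mem_interior_region (R : Rect) (q : ℝ × ℝ) :
    q ∈ interior R.region ↔ (R.west < q.1 ∧ q.1 < R.east) ∧ R.south < q.2 ∧ q.2 < R.north := by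
  rw [Rect.region, interior_prod_eq, interior_Icc, interior_Icc]
  rfl

lemma inside_iff (i : Fin k) (q : ℝ × ℝ) :
    C.layout.Inside i q.1 q.2 ↔ q ∈ interior (C.building i).base.region :=
  (mem_interior_region _ q).symm

lemma isClosed_region (R : Rect) : IsClosed R.region := isClosed_Icc.prod isClosed_Icc

lemma convex_region (R : Rect) : Convex ℝ R.region := (convex_Icc _ _).prod (convex_Icc _ _)

lemma corners_subset_region (R : Rect) : R.corners ⊆ R.region := by
  have := R.west_lt_east.le
  have := R.south_lt_north.le
  rintro ⟨x, y⟩ ⟨hx, hy⟩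
  simp only [Set.mem_insert_iff, Set.mem_singleton_iff] at hx hy
  constructor
  · rcases hx with rfl | rfl <;> simp [*]
  · rcases hy with rfl | rfl <;> simp [*]

/-- Walls and ground lie over the bounding rectangle, at non-negative height, and not over the
interior of a base. -/
lemma mem_of_mem_walls_union_ground {p : Space} (hp : p ∈ C.walls ∪ C.ground) :
    p.1 ∈ C.boundary.region ∧ 0 ≤ p.2 ∧
      ∀ i, p.1 ∉ interior (C.building i).base.region := by
  rcases hp with hp | hp
  · obtain ⟨i, hi, hz⟩ := Set.mem_iUnion.1 hp
    have hreg : p.1 ∈ (C.building i).base.region := (isClosed_region _).frontier_subset hi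
    refine ⟨C.base_subset i hreg, hz.1, fun j hj => ?_⟩
    rcases eq_or_ne i j with rfl | hne
    · exact hi.2 hj
    · exact Set.disjoint_left.1 (C.base_disjoint hne) hreg (interior_subset hj)
  · obtain ⟨⟨h1, h2⟩, h3⟩ := hp
    refine ⟨h1, (Set.mem_singleton_iff.1 h3).ge, fun i hi => h2 (Set.mem_iUnion.2 ⟨i, hi⟩)⟩

/-- A clear line of sight on the map lifts to a clear line of sight in space. -/
lemma segment_subset_freeSpace {q p : Space} (hq : q.1 ∈ C.boundary.region) (hq0 : 0 ≤ q.2)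
    (hp : p.1 ∈ C.boundary.region) (hp0 : 0 ≤ p.2)
    (hc : C.layout.Clear p.1.1 p.1.2 q.1.1 q.1.2) : segment ℝ q p ⊆ C.freeSpace := by
  rw [segment_symm, segment_eq_image']
  rintro _ ⟨t, ⟨h0, h1⟩, rfl⟩
  refine ⟨⟨?_, ?_⟩, ?_⟩
  · exact (convex_region _).add_smul_sub_mem hp hq ⟨h0, h1⟩
  · exact (convex_Ici (0 : ℝ)).add_smul_sub_mem hp0 hq0 ⟨h0, h1⟩
  · intro h
    obtain ⟨i, hi, _⟩ := Set.mem_iUnion.1 h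
    exact hc t h0 h1 i ((C.inside_iff i _).2 hi)

end City

end CityGuarding

theorem mainTheorem1 (k : ℕ) (hk : 1 ≤ k) (C : CityGuarding.City k) :
    ∃ G : Finset CityGuarding.Camera,
      G.card ≤ 2 * k + k / 4 + 4 ∧
      (∀ c ∈ G, ∃ i, c.position ∈ (C.building i).topVertices) ∧
      ∀ p ∈ C.walls ∪ C.ground, ∃ c ∈ G, c.Sees C p := by
  classical
  have : Nonempty (Fin k) := ⟨⟨0, hk⟩⟩
  obtain ⟨G, hN, hG, hc⟩ := C.layout.guardable
  rw [Fintype.card_fin] at hN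
  refine ⟨G.image fun c => ⟨(c.2.1, (C.building c.1).height), c.2.2⟩,
    Finset.card_image_le.trans hN, ?_, ?_⟩
  · intro c' hc'
    obtain ⟨c, hcG, rfl⟩ := Finset.mem_image.1 hc'
    exact ⟨c.1, hG c hcG, rfl⟩
  · intro p hp
    obtain ⟨h1, h2, h3⟩ := C.mem_of_mem_walls_union_ground hp
    obtain ⟨c, hcG, h4, h5⟩ := hc p.1.1 p.1.2 fun i hi => h3 i ((C.inside_iff i p.1).1 hi)
    refine ⟨_, Finset.mem_image_of_mem _ hcG, ?_, ?_⟩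
    · obtain ⟨i, q, d⟩ := c
      cases d <;> exact h4
    · exact C.segment_subset_freeSpace
        (C.base_subset c.1 (CityGuarding.City.corners_subset_region _ (hG c hcG)))
        (C.building c.1).height_pos.le h1 h2 h5
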